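/- Let $\mathbb D$ be the open unit disk and let $\Omega$ be the set of holomorphic maps $\omega:\mathbb D\to\mathbb D$ with $\omega(0)=0$. Let $\varphi,\psi$ be holomorphic functions on $\mathbb D$ with $\varphi(0)=0$, $\varphi'(0)\ne0$ and $\psi(0)\neq0$. Let $\mathcal A_{\varphi,\psi}$ be the class of all holomorphic functions $F$ on $\mathbb D$ of the form $F(z)=\varphi(z)\psi(\omega(z))$, $z\in\mathbb D$, with $\omega\in\Omega$. Each such $F$ satisfies $F(0)=0$ and $F'(0)\neq0$, so it has near $0$ a holomorphic inverse function $F^{-1}$ with $F^{-1}(0)=0$; let $\mathcal B_{\varphi,\psi}=\{F^{-1}:F\in\mathcal A_{\varphi,\psi}\}$. For $n\ge2$ let $$X^{(2)}_n(\mathcal B_{\varphi,\psi})=\Big\{(a_2,\dots,a_n)\in\mathbb C^{n-1}:\ \exists\, f\in\mathcal B_{\varphi,\psi},\ \exists\, a_0,a_1\in\mathbb C,\ f(z)=\sum_{k=0}^n a_kz^k+o(z^n)\ (z\to0)\Big\}.$$ Define functions $F_m$ on $\mathbb C^m$ by $F_1(z_1)=z_1$ and, for $m\ge2$, $$F_m(z_1,\dots,z_m)=(1-|z_1|^2)F_{m-1}(z_2,\dots,z_m)-\overline{z_1}\sum_{k=2}^{m-1}F_{m-k}(z_2,\dots,z_{m-k+1})\,F_k(z_1,\dots,z_k),$$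 and put $\overrightarrow F_{N}(z_1,\dots,z_N)=(F_1(z_1),F_2(z_1,z_2),\dots,F_N(z_1,\dots,z_N))$. **Theorem.** For every $n\ge2$ there is a polynomial map $\overrightarrow K_n:\mathbb C^{n-1}\to\mathbb C^{n-1}$ such that $\overrightarrow\Phi_n=\overrightarrow K_n\circ\overrightarrow F_{n-1}$ has the following properties. (i) $\overrightarrow\Phi_n$ is a continuous map of the closed polydisk $\overline{\mathbb D^{n-1}}$ onto $X^{(2)}_n(\mathcal B_{\varphi,\psi})$. (ii) If, in addition, $\psi'(0)\neq0$, then $\overrightarrow K_n$ is a polynomial automorphism of $\mathbb C^{n-1}$ (a bijection with polynomial inverse), $\overrightarrow\Phi_n(\mathbb D^{n-1})=\operatorname{int}X^{(2)}_n(\mathcal B_{\varphi,\psi})$, $\overrightarrow\Phi_n(\partial(\mathbb D^{n-1}))=\partial X^{(2)}_n(\mathcal B_{\varphi,\psi})$, and $\overrightarrow\Phi_n$ is a real-analytic diffeomorphism of $\mathbb D^{n-1}$ onto its (open) image; moreover, if $n\ge3$, then $\overrightarrow\Phi_n$ is not injective on $\partial(\mathbb D^{n-1})$. -/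

import Mathlib

open scoped Topology ComplexConjugate
open Filter Asymptotics

/-- The class `Ω` of holomorphic self-maps of the open unit disk that vanish at the origin. -/
def selfMapsVanishing : Set (ℂ → ℂ) :=
  {ω | DifferentiableOn ℂ ω (Metric.ball 0 1) ∧
    Set.MapsTo ω (Metric.ball 0 1) (Metric.ball 0 1) ∧ ω 0 = 0}

/-- The class `𝒜_{φ,ψ}`: holomorphic functions on the unit disk of the form
`F(z) = φ(z) ψ(ω(z))` with `ω ∈ Ω`. -/
def classA (φ ψ : ℂ → ℂ) : Set (ℂ → ℂ) :=
  {F | DifferentiableOn ℂ F (Metric.ball 0 1) ∧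
    ∃ ω ∈ selfMapsVanishing, ∀ z ∈ Metric.ball (0 : ℂ) 1, F z = φ z * ψ (ω z)}

/-- `G` is holomorphic around the origin, vanishes there, and is the inverse function of `F`
near the origin. -/
def IsInverseAtZero (F G : ℂ → ℂ) : Prop :=
  AnalyticAt ℂ G 0 ∧ G 0 = 0 ∧
    (∀ᶠ w in 𝓝 (0 : ℂ), F (G w) = w) ∧ (∀ᶠ z in 𝓝 (0 : ℂ), G (F z) = z)

/-- The class `ℬ_{φ,ψ} = {F⁻¹ : F ∈ 𝒜_{φ,ψ}}` of inverse functions (holomorphic around `0`). -/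
def classB (φ ψ : ℂ → ℂ) : Set (ℂ → ℂ) :=
  {G | ∃ F ∈ classA φ ψ, IsInverseAtZero F G}

/-- The coefficient body `X_n^{(2)}(𝓕)`: all vectors `(a_2, …, a_n)` for which some `f ∈ 𝓕` has
`f(z) = ∑_{k=0}^n a_k z^k + o(z^n)` as `z → 0` (with some `a_0`, `a_1`). -/
def coeffBodyTwo (n : ℕ) (𝓕 : Set (ℂ → ℂ)) : Set (Fin (n - 1) → ℂ) :=
  {v | ∃ f ∈ 𝓕, ∃ a : ℕ → ℂ,
    ((fun z : ℂ => f z - ∑ k ∈ Finset.range (n + 1), a k * z ^ k) =o[𝓝 0] fun z : ℂ => z ^ n) ∧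
    ∀ i : Fin (n - 1), v i = a ((i : ℕ) + 2)}

/-- The coordinates `F_m` of the Schur map. The variables are listed in a sequence that starts at
index `0`: `z k` stands for `z_{k+1}`, and `F_m` uses only `z_1, …, z_m`.
* `F_1(z_1) = z_1`;
* `F_m(z_1,…,z_m) = (1 - |z_1|²) F_{m-1}(z_2,…,z_m)
    - conj z_1 ∑_{k=2}^{m-1} F_{m-k}(z_2,…,z_{m-k+1}) F_k(z_1,…,z_k)` for `m ≥ 2`.
The value at `m = 0` is a dummy that is never used. In the last clause `m`, `k` stand for
`m - 2`, `k - 2` above. -/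
noncomputable def schurCoord : ℕ → (ℕ → ℂ) → ℂ
  | 0, _ => 0
  | 1, z => z 0
  | m + 2, z =>
      (1 - (‖z 0‖ : ℂ) ^ 2) * schurCoord (m + 1) (fun i => z (i + 1)) -
        conj (z 0) * ∑ k : Fin m,
          schurCoord (m - (k : ℕ)) (fun i => z (i + 1)) * schurCoord ((k : ℕ) + 2) z
  termination_by m _ => m
  decreasing_by all_goals omega

/-- The Schur map `(z_1,…,z_N) ↦ (F_1(z_1), F_2(z_1,z_2), …, F_N(z_1,…,z_N))` of `ℂ^N`. -/
noncomputable def schurMap (N : ℕ) (z : Fin N → ℂ) : Fin N → ℂ :=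
  fun i => schurCoord ((i : ℕ) + 1) (fun k => if h : k < N then z ⟨k, h⟩ else 0)

/-- The polynomial transformation of `ℂ^N` with coordinate polynomials `K`. -/
noncomputable def polyMap {N : ℕ} (K : Fin N → MvPolynomial (Fin N) ℂ) (z : Fin N → ℂ) :
    Fin N → ℂ :=
  fun i => MvPolynomial.eval z (K i)

/-- The polynomial transformation given by `K` is a polynomial automorphism of `ℂ^N`: it is
bijective and its inverse is polynomial. -/
def IsPolyAutomorphism {N : ℕ} (K : Fin N → MvPolynomial (Fin N) ℂ) : Prop :=
  ∃ J : Fin N → MvPolynomial (Fin N) ℂ,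
    Function.LeftInverse (polyMap J) (polyMap K) ∧ Function.RightInverse (polyMap J) (polyMap K)

/-- The open unit polydisk in `ℂ^N`. -/
def openPolydisk (N : ℕ) : Set (Fin N → ℂ) := {z | ∀ i, ‖z i‖ < 1}

/-- The closed unit polydisk in `ℂ^N`. -/
def closedPolydisk (N : ℕ) : Set (Fin N → ℂ) := {z | ∀ i, ‖z i‖ ≤ 1}

/-- `f` restricts to a real-analytic diffeomorphism of the open set `U` onto an open set: `f` is
real-analytic on `U`, `f(U)` is open, and `f` has on `U` an inverse that is real-analytic on
`f(U)`. -/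
def IsRealAnalyticDiffeoOn {N : ℕ} (f : (Fin N → ℂ) → (Fin N → ℂ)) (U : Set (Fin N → ℂ)) : Prop :=
  IsOpen U ∧ IsOpen (f '' U) ∧ AnalyticOnNhd ℝ f U ∧
    ∃ g : (Fin N → ℂ) → (Fin N → ℂ), AnalyticOnNhd ℝ g (f '' U) ∧ Set.LeftInvOn g f U

/-!
A self-map `ω ∈ Ω` is `z g(z)` with `g` in the Schur class (Schwarz lemma), and the Schur algorithm
writes `g = (γ + z g₁) / (1 + conj γ z g₁)` with `γ = g(0)` and `g₁` again in the Schur class.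
Comparing coefficients in `g (1 + conj γ z g₁) = γ + z g₁` gives exactly the recursion defining
`schurCoord`, so the Schur map sends the closed polydisk onto the set of coefficient vectors
`(c_1, …, c_N)` of the functions `ω` (`schurMap_image_closedPolydisk`). The formula for `g` makes
sense for `|γ| = 1` as well, so boundary parameters need no separate treatment in the construction.

As long as the preceding parameters lie in the open disk, the recursion can be solved for the next
one, by a formula that is rational in the coefficients and their conjugates (`schurParam`). Hence
the Schur map has a real-analytic inverse on the image of the open polydisk, which is the open set
of the vectors all of whose Schur parameters are of modulus less than `1`. A boundary point is not
mapped into the interior of the image, because its first unimodular parameter can be pushed out of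
the closed disk (`mem_openPolydisk_of_schurMap_mem_interior`). Since the image of the closed
polydisk is compact, this identifies its interior and frontier. Once the first parameter is
unimodular all later coefficients vanish, so the Schur map is not injective on the boundary in
dimension at least two.

The passage from `c` to the coefficients `a_2, …, a_n` of the inverse of `φ · (ψ ∘ ω)` is
polynomial, `a_{k+1}` depending on `c_1, …, c_k` only, and on `c_k` affinely with the constant slope
`-φ'(0) ψ'(0) / (φ'(0) ψ(0)) ^ (k + 2)` (`exists_polyMap_eq_invCoeff`). For `ψ'(0) ≠ 0` this
triangular map has a polynomial inverse (`isPolyAutomorphism_of_triangular`); it is then a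
homeomorphism of `ℂ^N`, and carries everything known about the Schur map over to the coefficient
body of the inverse functions (`coeffBodyTwo_classB`).
-/

/-! ### Triangular polynomial maps -/

/-- The coordinates of the inverse of the triangular polynomial map
`z ↦ (α i * z i + g i z)_i`, where `g i` involves the variables of index `< i` only. -/
noncomputable def triangularInverse {N : ℕ} (α : Fin N → ℂ) (g : Fin N → MvPolynomial (Fin N) ℂ)
    (i : Fin N) : MvPolynomial (Fin N) ℂ :=
  MvPolynomial.C (α i)⁻¹ * (MvPolynomial.X i -
    MvPolynomial.bind₁ (fun j => if _h : j < i then triangularInverse α g j else 0) (g i))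
  termination_by i.val

theorem eval_triangularInverse {N : ℕ} (α : Fin N → ℂ) (g : Fin N → MvPolynomial (Fin N) ℂ)
    (z : Fin N → ℂ) (i : Fin N) :
    MvPolynomial.eval z (triangularInverse α g i) =
      (α i)⁻¹ * (z i - MvPolynomial.eval
        (fun j => if j < i then MvPolynomial.eval z (triangularInverse α g j) else 0) (g i)) := by
  rw [triangularInverse]
  simp only [map_mul, map_sub, MvPolynomial.eval_C, MvPolynomial.eval_X]
  congr 2
  rw [MvPolynomial.eval, MvPolynomial.eval₂Hom_bind₁]
  congr 2
  funext j
  split_ifs <;> simp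

/-- A polynomial map whose `i`-th coordinate is affine in the `i`-th variable, with nonzero constant
slope `α i`, once the preceding variables are fixed, and does not depend on the later ones,
is a polynomial automorphism. -/
theorem isPolyAutomorphism_of_triangular {N : ℕ} (K : Fin N → MvPolynomial (Fin N) ℂ)
    (α : Fin N → ℂ) (hα : ∀ i, α i ≠ 0)
    (hK : ∀ i, ∀ c c' : Fin N → ℂ, (∀ j < i, c j = c' j) →
      MvPolynomial.eval c (K i) - MvPolynomial.eval c' (K i) = α i * (c i - c' i)) :
    IsPolyAutomorphism K := by
  set g : Fin N → MvPolynomial (Fin N) ℂ := fun i =>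
    K i - MvPolynomial.C (α i) * MvPolynomial.X i with hg
  have hKg : ∀ i c, MvPolynomial.eval c (K i) = α i * c i + MvPolynomial.eval c (g i) := by
    intro i c
    simp [hg]
  have hgc : ∀ i, ∀ c c' : Fin N → ℂ, (∀ j < i, c j = c' j) →
      MvPolynomial.eval c (g i) = MvPolynomial.eval c' (g i) := by
    intro i c c' h
    have := hK i c c' h
    rw [hKg, hKg] at this
    linear_combination this
  refine ⟨triangularInverse α g, fun z => ?_, fun z => ?_⟩
  · funext i
    induction i using WellFoundedLT.induction with
    | ind i ih =>
      change MvPolynomial.eval (polyMap K z) (triangularInverse α g i) = z i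
      rw [eval_triangularInverse, hgc i _ z]
      · rw [show polyMap K z i = MvPolynomial.eval z (K i) from rfl, hKg]
        field_simp [hα i]
        ring
      · intro j hj
        rw [if_pos hj]
        exact ih j hj
  · funext i
    change MvPolynomial.eval (polyMap (triangularInverse α g) z) (K i) = z i
    rw [hKg, show polyMap (triangularInverse α g) z i =
      MvPolynomial.eval z (triangularInverse α g i) from rfl, eval_triangularInverse,
      hgc i _ (polyMap (triangularInverse α g) z)]
    · field_simp [hα i]
      ring
    · intro j hj
      rw [if_pos hj]
      rfl

/-! ### Functions given by polynomials in several variables -/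

/-- `f` is the function on `ℂ^N` defined by some polynomial. -/
def IsPolynomialFun {N : ℕ} (f : (Fin N → ℂ) → ℂ) : Prop :=
  ∃ P : MvPolynomial (Fin N) ℂ, ∀ c, MvPolynomial.eval c P = f c

namespace IsPolynomialFun

variable {N : ℕ} {f g : (Fin N → ℂ) → ℂ}

theorem const (a : ℂ) : IsPolynomialFun fun _ : Fin N → ℂ => a :=
  ⟨MvPolynomial.C a, fun c => by simp⟩

theorem apply (i : Fin N) : IsPolynomialFun fun c : Fin N → ℂ => c i :=
  ⟨MvPolynomial.X i, fun c => by simp⟩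

theorem mul (hf : IsPolynomialFun f) (hg : IsPolynomialFun g) :
    IsPolynomialFun fun c => f c * g c := by
  obtain ⟨P, hP⟩ := hf
  obtain ⟨Q, hQ⟩ := hg
  exact ⟨P * Q, fun c => by simp [hP, hQ]⟩

theorem sum {ι : Type*} (s : Finset ι) {f : ι → (Fin N → ℂ) → ℂ}
    (hf : ∀ i, IsPolynomialFun (f i)) : IsPolynomialFun fun c => ∑ i ∈ s, f i c := by
  choose P hP using hf
  exact ⟨∑ i ∈ s, P i, fun c => by simp [hP]⟩

theorem coeff_mul {p q : (Fin N → ℂ) → Polynomial ℂ}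
    (hp : ∀ k, IsPolynomialFun fun c => (p c).coeff k)
    (hq : ∀ k, IsPolynomialFun fun c => (q c).coeff k) (k : ℕ) :
    IsPolynomialFun fun c => (p c * q c).coeff k := by
  simp only [Polynomial.coeff_mul]
  exact sum _ fun x => (hp x.1).mul (hq x.2)

theorem coeff_pow {p : (Fin N → ℂ) → Polynomial ℂ}
    (hp : ∀ k, IsPolynomialFun fun c => (p c).coeff k) (j k : ℕ) :
    IsPolynomialFun fun c => (p c ^ j).coeff k := by
  induction j generalizing k with
  | zero => simpa using const (N := N) ((1 : Polynomial ℂ).coeff k)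
  | succ j ih =>
    simp only [pow_succ]
    exact coeff_mul ih hp k

theorem coeff_comp (P : Polynomial ℂ) {p : (Fin N → ℂ) → Polynomial ℂ}
    (hp : ∀ k, IsPolynomialFun fun c => (p c).coeff k) (k : ℕ) :
    IsPolynomialFun fun c => (P.comp (p c)).coeff k := by
  simp only [Polynomial.comp_eq_sum_left, Polynomial.sum, Polynomial.finsetSum_coeff,
    Polynomial.coeff_C_mul]
  exact sum _ fun j => (const _).mul (coeff_pow hp j k)

end IsPolynomialFun

/-! ### Substitution and inversion of polynomials modulo powers of the variable -/

section Jets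

open Polynomial

theorem X_pow_dvd_pow_sub_pow {U V : ℂ[X]} (hU : X ∣ U) (hV : X ∣ V) {m : ℕ}
    {δ : ℂ} (h : X ^ (m + 1) ∣ U - V - C δ * X ^ m) {k : ℕ} (hk : 2 ≤ k) :
    X ^ (m + 1) ∣ U ^ k - V ^ k := by
  have h0 : X ^ m ∣ U - V := by
    have h1 : X ^ m ∣ U - V - C δ * X ^ m := (pow_dvd_pow X (Nat.le_succ m)).trans h
    have := dvd_add h1 (dvd_mul_left (X ^ m) (C δ))
    simpa using this
  obtain ⟨k, rfl⟩ : ∃ j, k = j + 2 := ⟨k - 2, by omega⟩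
  have e : U ^ (k + 2) - V ^ (k + 2) =
      (U - V) * U ^ (k + 1) + (U ^ (k + 1) - V ^ (k + 1)) * V := by ring
  rw [e, pow_succ]
  exact dvd_add (mul_dvd_mul h0 (hU.trans (dvd_pow_self U (by omega))))
    (mul_dvd_mul (h0.trans (sub_dvd_pow_sub_pow U V (k + 1))) hV)

/-- The derivative of `U ↦ P ∘ U` modulo `X ^ (m + 1)`: changing the coefficient of `X ^ m` in `U`
by `δ` changes that of `P ∘ U` by `P'(0) δ`. -/
theorem X_pow_dvd_comp_sub_comp (P : ℂ[X]) {U V : ℂ[X]} (hU : X ∣ U) (hV : X ∣ V) {m : ℕ}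
    {δ : ℂ} (h : X ^ (m + 1) ∣ U - V - C δ * X ^ m) :
    X ^ (m + 1) ∣ P.comp U - P.comp V - C (P.coeff 1 * δ) * X ^ m := by
  induction P using Polynomial.induction_on' with
  | add p q hp hq =>
    have e : (p + q).comp U - (p + q).comp V - C ((p + q).coeff 1 * δ) * X ^ m =
        (p.comp U - p.comp V - C (p.coeff 1 * δ) * X ^ m) +
        (q.comp U - q.comp V - C (q.coeff 1 * δ) * X ^ m) := by
      simp only [add_comp, coeff_add, add_mul, C_add]
      ring
    rw [e]
    exact dvd_add hp hq
  | monomial k a =>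
    obtain rfl | rfl | hk : k = 0 ∨ k = 1 ∨ 2 ≤ k := by omega
    · simp
    · have e : (monomial 1 a).comp U - (monomial 1 a).comp V -
          C ((monomial 1 a).coeff 1 * δ) * X ^ m = C a * (U - V - C δ * X ^ m) := by
        simp only [monomial_comp, coeff_monomial_same, C_mul]
        ring
      rw [e]
      exact h.mul_left _
    · have e : (monomial k a).comp U - (monomial k a).comp V -
          C ((monomial k a).coeff 1 * δ) * X ^ m = C a * (U ^ k - V ^ k) := by
        rw [coeff_monomial_of_ne _ (by omega : (1 : ℕ) ≠ k)]
        simp only [monomial_comp]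
        simp
        ring
      rw [e]
      exact (X_pow_dvd_pow_sub_pow hU hV h hk).mul_left _

/-- The coefficients of the compositional inverse `G` of `H`, where `H(0) = 0` and `H'(0) ≠ 0`. The
recursion compares coefficients in `G ∘ H = X`. -/
noncomputable def invCoeff (H : ℂ[X]) : ℕ → ℂ
  | 0 => 0
  | 1 => (H.coeff 1)⁻¹
  | m + 2 => -((H.coeff 1)⁻¹ ^ (m + 2) *
      ∑ k : Fin (m + 2), invCoeff H k * (H ^ (k : ℕ)).coeff (m + 2))

theorem coeff_pow_of_X_dvd {H : ℂ[X]} (hH : X ∣ H) {k m : ℕ} (hm : m < k) :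
    (H ^ k).coeff m = 0 :=
  X_pow_dvd_iff.1 (pow_dvd_pow_of_dvd hH k) m hm

theorem coeff_X_mul_one (Q : ℂ[X]) : (X * Q).coeff 1 = Q.coeff 0 :=
  coeff_X_mul Q 0

theorem coeff_pow_self_of_X_dvd {H : ℂ[X]} (hH : X ∣ H) (k : ℕ) :
    (H ^ k).coeff k = H.coeff 1 ^ k := by
  obtain ⟨Q, rfl⟩ := hH
  have h2 := coeff_X_pow_mul (Q ^ k) k 0
  rw [coeff_X_mul_one, mul_pow]
  rw [zero_add] at h2
  rw [h2, coeff_zero_eq_eval_zero, coeff_zero_eq_eval_zero, eval_pow]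

theorem coeff_comp_of_X_dvd (P : ℂ[X]) {H : ℂ[X]} (hH : X ∣ H) (m : ℕ) :
    (P.comp H).coeff m = ∑ k ∈ Finset.range (m + 1), P.coeff k * (H ^ k).coeff m := by
  rw [comp, eval₂_eq_sum_range' C (n := max (P.natDegree + 1) (m + 1)) (by omega)]
  simp only [finsetSum_coeff, coeff_C_mul]
  symm
  refine Finset.sum_subset (fun k hk => ?_) fun k _ hk => ?_
  · simp only [Finset.mem_range] at hk ⊢
    omega
  · rw [coeff_pow_of_X_dvd hH (by simpa using hk), mul_zero]

/-- The equation `P ∘ H = X` modulo `X ^ (n + 1)` determines the coefficients of `P` up to order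
`n`. -/
theorem coeff_eq_invCoeff {P H : ℂ[X]} (hH : X ∣ H) (hH1 : H.coeff 1 ≠ 0) {n : ℕ}
    (h : ∀ k ≤ n, (P.comp H).coeff k = (X : ℂ[X]).coeff k) :
    ∀ k ≤ n, P.coeff k = invCoeff H k := by
  intro k
  induction k using Nat.strong_induction_on with
  | _ k ih =>
    intro hk
    have hc := h k hk
    rw [coeff_comp_of_X_dvd P hH, Finset.sum_range_succ, coeff_pow_self_of_X_dvd hH] at hc
    match k, ih, hk, hc with
    | 0, ih, hk, hc => simpa [invCoeff] using hc
    | 1, ih, hk, hc =>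
      have h0 : P.coeff 0 = 0 := by
        rw [ih 0 one_pos (by omega), invCoeff]
      simp only [Finset.sum_range_one, h0, zero_mul, zero_add, pow_one, coeff_X_one] at hc
      rw [invCoeff]
      exact eq_inv_of_mul_eq_one_left hc
    | m + 2, ih, hk, hc =>
      have e : ∑ x ∈ Finset.range (m + 2), P.coeff x * (H ^ x).coeff (m + 2) =
          ∑ k : Fin (m + 2), invCoeff H k * (H ^ (k : ℕ)).coeff (m + 2) := by
        rw [← Fin.sum_univ_eq_sum_range (fun x => P.coeff x * (H ^ x).coeff (m + 2))]
        exact Finset.sum_congr rfl fun x _ => by rw [ih x x.2 (by omega)]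
      rw [e, coeff_X_of_ne_one (by omega)] at hc
      rw [invCoeff, inv_pow, eq_neg_iff_add_eq_zero, ← mul_right_inj' (pow_ne_zero (m + 2) hH1),
        mul_zero, mul_add, mul_inv_cancel_left₀ (pow_ne_zero (m + 2) hH1)]
      linear_combination hc

theorem IsPolynomialFun.invCoeff {N : ℕ} {H : (Fin N → ℂ) → ℂ[X]} {b : ℂ}
    (hH : ∀ k, IsPolynomialFun fun c => (H c).coeff k) (hb : ∀ c, (H c).coeff 1 = b) (m : ℕ) :
    IsPolynomialFun fun c => invCoeff (H c) m := by
  induction m using Nat.strong_induction_on with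
  | _ m ih =>
    match m, ih with
    | 0, _ => simpa [_root_.invCoeff] using const (N := N) 0
    | 1, _ => simpa [_root_.invCoeff, hb] using const (N := N) b⁻¹
    | m + 2, ih =>
      have := (const (N := N) (-(b⁻¹ ^ (m + 2)))).mul
        (sum Finset.univ fun k : Fin (m + 2) => (ih k k.2).mul (coeff_pow hH k (m + 2)))
      simpa [_root_.invCoeff, hb] using this

theorem coeff_eq_of_X_pow_dvd {U V : ℂ[X]} {m : ℕ} {δ : ℂ}
    (h : X ^ (m + 1) ∣ U - V - C δ * X ^ m) {k : ℕ} (hk : k < m) : U.coeff k = V.coeff k := by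
  have := X_pow_dvd_iff.1 h k (by omega)
  simp only [coeff_sub, coeff_C_mul, coeff_X_pow, if_neg hk.ne, mul_zero, sub_zero] at this
  exact sub_eq_zero.1 this

theorem coeff_sub_of_X_pow_dvd {U V : ℂ[X]} {m : ℕ} {δ : ℂ}
    (h : X ^ (m + 1) ∣ U - V - C δ * X ^ m) : U.coeff m - V.coeff m = δ := by
  have := X_pow_dvd_iff.1 h m (by omega)
  simp only [coeff_sub, coeff_C_mul, coeff_X_pow, if_true, mul_one] at this
  exact sub_eq_zero.1 this

/-- Changing the coefficient of `X ^ (m + 2)` in `H` by `δ` changes the coefficient of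
`X ^ (m + 2)` in the inverse series by `-δ / H'(0) ^ (m + 3)`. -/
theorem invCoeff_sub_invCoeff {H G : ℂ[X]} (hH : X ∣ H) (hG : X ∣ G)
    {m : ℕ} {δ : ℂ} (h : X ^ (m + 2 + 1) ∣ H - G - C δ * X ^ (m + 2)) :
    invCoeff H (m + 2) - invCoeff G (m + 2) = -((H.coeff 1)⁻¹ ^ (m + 3) * δ) := by
  have h1 : H.coeff 1 = G.coeff 1 := coeff_eq_of_X_pow_dvd h (by omega)
  have hlow : ∀ k < m + 2, invCoeff H k = invCoeff G k := by
    intro k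
    induction k using Nat.strong_induction_on with
    | _ k ih =>
      intro hk
      match k, ih, hk with
      | 0, _, _ => simp [invCoeff]
      | 1, _, _ => simp [invCoeff, h1]
      | j + 2, ih, hk =>
        rw [invCoeff, invCoeff, h1]
        congr 2
        refine Finset.sum_congr rfl fun x _ => ?_
        rw [ih x x.2 (by omega)]
        congr 1
        have hd : X ^ (m + 2) ∣ H ^ (x : ℕ) - G ^ (x : ℕ) := by
          refine dvd_trans ?_ (sub_dvd_pow_sub_pow H G x)
          have h1 := (pow_dvd_pow X (Nat.le_succ (m + 2))).trans h
          simpa using dvd_add h1 (dvd_mul_left (X ^ (m + 2)) (C δ))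
        have := X_pow_dvd_iff.1 hd (j + 2) hk
        rw [coeff_sub] at this
        exact sub_eq_zero.1 this
  have hsum : ∑ k : Fin (m + 2), invCoeff H k * (H ^ (k : ℕ)).coeff (m + 2) -
      ∑ k : Fin (m + 2), invCoeff G k * (G ^ (k : ℕ)).coeff (m + 2) = (H.coeff 1)⁻¹ * δ := by
    rw [← Finset.sum_sub_distrib, Finset.sum_eq_single (1 : Fin (m + 2))]
    · have h1v : ((1 : Fin (m + 2)) : ℕ) = 1 := rfl
      rw [h1v, ← hlow 1 (by omega), pow_one, pow_one, ← mul_sub, coeff_sub_of_X_pow_dvd h, invCoeff]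
    · intro k _ hk
      rw [← hlow k k.2]
      have hk1 : (k : ℕ) ≠ 1 := fun h => hk (Fin.ext h)
      obtain h0 | h2 : (k : ℕ) = 0 ∨ 2 ≤ (k : ℕ) := by omega
      · simp [h0]
      · have := X_pow_dvd_iff.1 (X_pow_dvd_pow_sub_pow hH hG h h2) (m + 2) (by omega)
        rw [coeff_sub] at this
        rw [← mul_sub, this, mul_zero]
    · simp
  rw [invCoeff, invCoeff, ← h1]
  linear_combination (-(H.coeff 1)⁻¹ ^ (m + 2)) * hsum

/-- The polynomial `c_1 X + ⋯ + c_N X ^ N` whose coefficients are the coordinates of `c`. -/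
noncomputable def coeffPoly {N : ℕ} (c : Fin N → ℂ) : ℂ[X] :=
  ∑ k : Fin N, C (c k) * X ^ ((k : ℕ) + 1)

theorem X_dvd_coeffPoly {N : ℕ} (c : Fin N → ℂ) : X ∣ coeffPoly c :=
  Finset.dvd_sum fun _ _ => (dvd_pow_self X (Nat.succ_ne_zero _)).mul_left _

theorem isPolynomialFun_coeff_coeffPoly {N : ℕ} (k : ℕ) :
    IsPolynomialFun fun c : Fin N → ℂ => (coeffPoly c).coeff k := by
  simp only [coeffPoly, finsetSum_coeff, coeff_C_mul]
  exact IsPolynomialFun.sum _ fun i => (IsPolynomialFun.apply i).mul (IsPolynomialFun.const _)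

theorem X_pow_dvd_coeffPoly_sub {N : ℕ} {c c' : Fin N → ℂ} {i : Fin N}
    (h : ∀ j < i, c j = c' j) :
    X ^ ((i : ℕ) + 1 + 1) ∣ coeffPoly c - coeffPoly c' - C (c i - c' i) * X ^ ((i : ℕ) + 1) := by
  have e : coeffPoly c - coeffPoly c' - C (c i - c' i) * X ^ ((i : ℕ) + 1) =
      ∑ k ∈ Finset.univ.erase i, C (c k - c' k) * X ^ ((k : ℕ) + 1) := by
    rw [coeffPoly, coeffPoly, ← Finset.sum_sub_distrib, sub_eq_iff_eq_add,
      Finset.sum_erase_add _ _ (Finset.mem_univ i)]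
    exact Finset.sum_congr rfl fun _ _ => by rw [C_sub, sub_mul]
  rw [e]
  refine Finset.dvd_sum fun k hk => ?_
  have hki := Finset.ne_of_mem_erase hk
  rcases lt_or_gt_of_ne hki with hlt | hgt
  · simp [h k hlt]
  · exact (pow_dvd_pow X (by have : (i : ℕ) < k := hgt; omega)).mul_left _

theorem X_pow_dvd_mul_comp_coeffPoly_sub {N : ℕ} {p : ℂ[X]} (hp : X ∣ p) (q : ℂ[X])
    {c c' : Fin N → ℂ} {i : Fin N} (h : ∀ j < i, c j = c' j) :
    X ^ ((i : ℕ) + 2 + 1) ∣ p * q.comp (coeffPoly c) - p * q.comp (coeffPoly c') -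
      C (p.coeff 1 * (q.coeff 1 * (c i - c' i))) * X ^ ((i : ℕ) + 2) := by
  have h1 := X_pow_dvd_comp_sub_comp q (X_dvd_coeffPoly c) (X_dvd_coeffPoly c')
    (X_pow_dvd_coeffPoly_sub h)
  obtain ⟨p₁, rfl⟩ := hp
  have h2 : X ∣ p₁ - C (p₁.coeff 0) := by
    rw [X_dvd_iff]
    simp
  rw [coeff_X_mul_one]
  set δ := q.coeff 1 * (c i - c' i)
  have e : X * p₁ * q.comp (coeffPoly c) - X * p₁ * q.comp (coeffPoly c') -
      C (p₁.coeff 0 * δ) * X ^ ((i : ℕ) + 2) =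
      (X ^ ((i : ℕ) + 1) * X) * (p₁ - C (p₁.coeff 0)) * C δ +
      (q.comp (coeffPoly c) - q.comp (coeffPoly c') - C δ * X ^ ((i : ℕ) + 1)) * X * p₁ := by
    rw [C_mul]
    ring
  rw [e]
  refine dvd_add ?_ ?_
  · rw [pow_succ, pow_succ]
    exact (mul_dvd_mul dvd_rfl h2).mul_right _
  · rw [show (i : ℕ) + 2 + 1 = (i : ℕ) + 1 + 1 + 1 by omega, pow_succ]
    exact (mul_dvd_mul h1 dvd_rfl).mul_right _

theorem coeff_one_mul_comp_coeffPoly {N : ℕ} {p : ℂ[X]} (hp : X ∣ p) (q : ℂ[X])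
    (c : Fin N → ℂ) : (p * q.comp (coeffPoly c)).coeff 1 = p.coeff 1 * q.coeff 0 := by
  obtain ⟨p₁, rfl⟩ := hp
  obtain ⟨w, hw⟩ := X_dvd_coeffPoly c
  rw [mul_assoc, coeff_X_mul_one, coeff_X_mul_one, hw]
  simp [coeff_zero_eq_eval_zero]

/-- The polynomial map that sends the coefficients of `ω` to those of the inverse of `φ · (ψ ∘ ω)`,
where `p`, `q` are Taylor polynomials of `φ`, `ψ`. It is triangular with diagonal proportional
to `ψ'(0)`. -/
theorem exists_polyMap_eq_invCoeff (p q : ℂ[X]) (hp : X ∣ p) (N : ℕ) :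
    ∃ K : Fin N → MvPolynomial (Fin N) ℂ,
      (∀ c i, polyMap K c i = invCoeff (p * q.comp (coeffPoly c)) ((i : ℕ) + 2)) ∧
      (p.coeff 1 ≠ 0 → q.coeff 0 ≠ 0 → q.coeff 1 ≠ 0 → IsPolyAutomorphism K) := by
  have hX : ∀ c : Fin N → ℂ, X ∣ p * q.comp (coeffPoly c) := fun c => hp.mul_right _
  have hb : ∀ c : Fin N → ℂ, (p * q.comp (coeffPoly c)).coeff 1 = p.coeff 1 * q.coeff 0 :=
    fun c => coeff_one_mul_comp_coeffPoly hp q c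
  have hpoly := fun i : Fin N => IsPolynomialFun.invCoeff (N := N)
    (H := fun c => p * q.comp (coeffPoly c))
    (IsPolynomialFun.coeff_mul (fun k => IsPolynomialFun.const (p.coeff k))
      (IsPolynomialFun.coeff_comp q isPolynomialFun_coeff_coeffPoly)) hb (i + 2)
  choose K hK using hpoly
  refine ⟨K, fun c i => hK i c, fun h1 h2 h3 => ?_⟩
  refine isPolyAutomorphism_of_triangular K
    (fun i => -((p.coeff 1 * q.coeff 0)⁻¹ ^ ((i : ℕ) + 3) * (p.coeff 1 * q.coeff 1)))
    (fun i => ?_) fun i c c' h => ?_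
  · simp [h1, h2, h3]
  · rw [hK, hK, invCoeff_sub_invCoeff (hX c) (hX c') (X_pow_dvd_mul_comp_coeffPoly_sub hp q h), hb]
    ring

end Jets

/-! ### Taylor polynomials at the origin -/

section TaylorPolynomials

open Polynomial

/-- `p` is a Taylor polynomial of order `n` of `f` at the origin: `f z = p z + o(z ^ n)`. The
degree of `p` is not restricted, so that products and compositions of Taylor polynomials need not
be truncated; only the coefficients up to order `n` are determined by `f`. -/
def HasJet (n : ℕ) (f : ℂ → ℂ) (p : ℂ[X]) : Prop :=
  (fun z => f z - p.eval z) =o[𝓝 0] fun z : ℂ => z ^ n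

theorem Polynomial.eval_isBigO_one (p : ℂ[X]) : (p.eval ·) =O[𝓝 0] fun _ : ℂ => (1 : ℂ) :=
  p.continuous.continuousAt.isBigO_one ℂ

theorem pow_isBigO_pow_nhds_zero {m n : ℕ} (h : m ≤ n) :
    (fun z : ℂ => z ^ n) =O[𝓝 0] fun z : ℂ => z ^ m := by
  obtain ⟨k, rfl⟩ := Nat.exists_eq_add_of_le h
  have h1 : (fun z : ℂ => z ^ k) =O[𝓝 0] fun _ : ℂ => (1 : ℂ) :=
    (continuous_pow k).continuousAt.isBigO_one ℂ
  simpa [pow_add] using (isBigO_refl (fun z : ℂ => z ^ m) (𝓝 0)).mul h1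

theorem Polynomial.eval_isBigO_pow {p : ℂ[X]} {k : ℕ} (h : X ^ k ∣ p) :
    (p.eval ·) =O[𝓝 0] fun z : ℂ => z ^ k := by
  obtain ⟨q, rfl⟩ := h
  simpa using (isBigO_refl (fun z : ℂ => z ^ k) (𝓝 0)).mul q.eval_isBigO_one

namespace HasJet

variable {n : ℕ} {f g : ℂ → ℂ} {p q : ℂ[X]}

theorem mono {m : ℕ} (hf : HasJet n f p) (h : m ≤ n) : HasJet m f p :=
  IsLittleO.trans_isBigO hf (pow_isBigO_pow_nhds_zero h)

theorem eval (p : ℂ[X]) : HasJet n (p.eval ·) p := by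
  simp [HasJet]

theorem congr (hf : HasJet n f p) (h : f =ᶠ[𝓝 0] g) : HasJet n g p :=
  IsLittleO.congr' hf (h.mono fun z hz => by simp [hz]) EventuallyEq.rfl

theorem congr_poly (hf : HasJet n f p) (h : X ^ (n + 1) ∣ p - q) : HasJet n f q := by
  have h1 : (fun z : ℂ => z ^ (n + 1)) =o[𝓝 0] fun z : ℂ => z ^ n :=
    isLittleO_pow_pow (Nat.lt_succ_self n)
  refine (IsLittleO.add hf ((Polynomial.eval_isBigO_pow h).trans_isLittleO h1)).congr_left
    fun z => ?_
  simp

theorem add (hf : HasJet n f p) (hg : HasJet n g q) : HasJet n (fun z => f z + g z) (p + q) :=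
  (IsLittleO.add hf hg).congr_left fun z => by simp; ring

theorem isBigO_one (hf : HasJet n f p) : f =O[𝓝 0] fun _ : ℂ => (1 : ℂ) := by
  have h1 : (fun z : ℂ => z ^ n) =O[𝓝 0] fun _ : ℂ => (1 : ℂ) := by
    simpa using pow_isBigO_pow_nhds_zero (Nat.zero_le n)
  simpa using (hf.isBigO.trans h1).add p.eval_isBigO_one

theorem mul (hf : HasJet n f p) (hg : HasJet n g q) : HasJet n (fun z => f z * g z) (p * q) := by
  have h1 := hf.mul_isBigO hg.isBigO_one
  have h2 := p.eval_isBigO_one.mul_isLittleO hg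
  simp only [mul_one, one_mul] at h1 h2
  exact (h1.add h2).congr_left fun z => by simp; ring

/-- A factor that vanishes at the origin improves the order of the Taylor polynomial. -/
theorem mul_of_X_dvd (hf : HasJet (n + 1) f p) (hp : X ∣ p) (hg : HasJet n g q) :
    HasJet (n + 1) (fun z => f z * g z) (p * q) := by
  have h1 := hf.mul_isBigO hg.isBigO_one
  have h2 := (Polynomial.eval_isBigO_pow (k := 1) (by simpa using hp)).mul_isLittleO hg
  simp only [mul_one, ← pow_add, add_comm 1 n] at h1 h2
  exact (h1.add h2).congr_left fun z => by simp; ring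

theorem eval_comp (P : ℂ[X]) (hf : HasJet n f p) : HasJet n (fun z => P.eval (f z)) (P.comp p) := by
  induction P using Polynomial.induction_on with
  | C a => simpa using HasJet.eval (n := n) (C a)
  | add P Q hP hQ => simpa using hP.add hQ
  | monomial k a h =>
    have := h.mul hf
    simpa [pow_succ, mul_assoc] using this

theorem isBigO_id (hf : HasJet n f p) (hn : 1 ≤ n) (hp : X ∣ p) : f =O[𝓝 0] fun z : ℂ => z := by
  have h1 := IsLittleO.isBigO (hf.mono hn)
  have h2 := Polynomial.eval_isBigO_pow (k := 1) (p := p) (by simpa using hp)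
  simpa using h1.add h2

theorem comp (hf : HasJet n f p) (hg : HasJet n g q) (hn : 1 ≤ n) (hq : X ∣ q) :
    HasJet n (fun z => f (g z)) (p.comp q) := by
  have hO := hg.isBigO_id hn hq
  have ht : Tendsto g (𝓝 0) (𝓝 0) := hO.trans_tendsto tendsto_id
  have h1 : (fun z => f (g z) - p.eval (g z)) =o[𝓝 0] fun z : ℂ => z ^ n :=
    (IsLittleO.comp_tendsto hf ht).trans_isBigO (hO.pow n)
  refine (h1.add (hg.eval_comp p)).congr_left fun z => ?_
  ring

theorem coeff_zero (hf : HasJet n f p) : p.coeff 0 = f 0 := by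
  have h := (hf.mono (Nat.zero_le n))
  unfold HasJet at h
  simp only [pow_zero, isLittleO_one_iff] at h
  have h2 : f 0 - p.eval 0 = 0 := tendsto_nhds_unique (tendsto_pure_nhds _ _)
    (h.mono_left (pure_le_nhds 0))
  rw [coeff_zero_eq_eval_zero]
  exact (sub_eq_zero.1 h2).symm

theorem hasDerivAt (hf : HasJet n f p) (hn : 1 ≤ n) : HasDerivAt f (p.coeff 1) 0 := by
  have h := hf.mono hn
  have h1 : HasDerivAt (fun z => f z - p.eval z) 0 0 := by
    rw [hasDerivAt_iff_isLittleO]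
    unfold HasJet at h
    have e : f 0 - p.eval 0 = 0 := by
      rw [← coeff_zero_eq_eval_zero, hf.coeff_zero, sub_self]
    simpa [e] using h
  have h2 := h1.add (p.hasDerivAt 0)
  rw [zero_add, ← coeff_zero_eq_eval_zero, coeff_derivative] at h2
  refine (h2.congr_deriv (by simp)).congr_of_eventuallyEq (Eventually.of_forall fun z => ?_)
  simp

theorem coeff_eq_zero (hp : HasJet n 0 p) : ∀ k ≤ n, p.coeff k = 0 := by
  intro k
  induction k using Nat.strong_induction_on with
  | _ k ih =>
    intro hk
    obtain ⟨q, rfl⟩ : X ^ k ∣ p := X_pow_dvd_iff.2 fun j hj => ih j hj (hj.le.trans hk)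
    have h : (fun z : ℂ => z ^ k * q.eval z) =o[𝓝 0] fun z : ℂ => z ^ k := by
      have := (hp.mono hk).neg_left
      simpa using this
    have h1 : (q.eval ·) =o[𝓝[≠] 0] fun _ : ℂ => (1 : ℂ) := by
      rw [isLittleO_iff] at h ⊢
      intro c hc
      filter_upwards [(h hc).filter_mono nhdsWithin_le_nhds, self_mem_nhdsWithin] with z hz hz0
      have hpos : 0 < ‖z ^ k‖ := norm_pos_iff.2 (pow_ne_zero k hz0)
      rw [norm_mul, mul_comm] at hz
      simpa using le_of_mul_le_mul_right hz hpos
    rw [isLittleO_one_iff] at h1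
    have h2 : Tendsto (q.eval ·) (𝓝[≠] (0 : ℂ)) (𝓝 (q.eval 0)) :=
      q.continuous.continuousAt.mono_left nhdsWithin_le_nhds
    have h3 := coeff_X_pow_mul q k 0
    rw [zero_add] at h3
    rw [h3, coeff_zero_eq_eval_zero]
    exact tendsto_nhds_unique h2 h1

theorem coeff_eq (hp : HasJet n f p) (hq : HasJet n f q) : ∀ k ≤ n, p.coeff k = q.coeff k := by
  intro k hk
  have h : HasJet n 0 (p - q) := by
    refine (IsLittleO.sub hp hq).congr_left fun z => ?_
    simp
  have := h.coeff_eq_zero k hk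
  rw [coeff_sub] at this
  exact sub_eq_zero.1 this

end HasJet

theorem AnalyticAt.exists_hasJet {f : ℂ → ℂ} (hf : AnalyticAt ℂ f 0) (n : ℕ) :
    ∃ p : ℂ[X], HasJet n f p := by
  obtain ⟨s, hs⟩ := hf
  refine ⟨∑ k ∈ Finset.range (n + 1), C (s.coeff k) * X ^ k, ?_⟩
  have h := hs.isBigO_sub_partialSum_pow (n + 1)
  have h1 : (fun z : ℂ => z ^ (n + 1)) =o[𝓝 0] fun z : ℂ => z ^ n :=
    isLittleO_pow_pow (Nat.lt_succ_self n)
  simp only [← norm_pow] at h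
  refine (h.of_norm_right.trans_isLittleO h1).congr_left fun z => ?_
  simp only [zero_add, FormalMultilinearSeries.partialSum, eval_finsetSum, eval_mul, eval_C,
    eval_pow, eval_X, FormalMultilinearSeries.apply_eq_pow_smul_coeff, smul_eq_mul, mul_comm]

theorem exists_isInverseAtZero {F : ℂ → ℂ} (hF : AnalyticAt ℂ F 0) (h0 : F 0 = 0)
    (h1 : deriv F 0 ≠ 0) : ∃ G, IsInverseAtZero F G := by
  have hs := hF.hasStrictDerivAt
  refine ⟨hs.localInverse _ _ _ h1, ?_, ?_, ?_, ?_⟩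
  · simpa [h0] using hF.analyticAt_localInverse h1
  · have := HasStrictFDerivAt.localInverse_apply_image (hs.hasStrictFDerivAt_equiv h1)
    rwa [h0] at this
  · have := hs.eventually_right_inverse h1
    rwa [h0] at this
  · exact HasStrictFDerivAt.eventually_left_inverse (hs.hasStrictFDerivAt_equiv h1)

end TaylorPolynomials

/-! ### The Schur map and its inverse -/

/-- The sequence `(F_1(z), F_2(z), …)`, indexed from `0`. -/
noncomputable def schurSeq (z : ℕ → ℂ) (m : ℕ) : ℂ := schurCoord (m + 1) z

theorem schurSeq_zero (z : ℕ → ℂ) : schurSeq z 0 = z 0 := by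
  rw [schurSeq, schurCoord]

theorem schurSeq_succ (z : ℕ → ℂ) (m : ℕ) :
    schurSeq z (m + 1) = (1 - (‖z 0‖ : ℂ) ^ 2) * schurSeq (fun i => z (i + 1)) m -
      conj (z 0) * ∑ k ∈ Finset.range m,
        schurSeq (fun i => z (i + 1)) (m - 1 - k) * schurSeq z (k + 1) := by
  rw [schurSeq, schurCoord, ← Fin.sum_univ_eq_sum_range
    (fun k => schurSeq (fun i => z (i + 1)) (m - 1 - k) * schurSeq z (k + 1))]
  congr 2
  refine Finset.sum_congr rfl fun k _ => ?_
  rw [schurSeq, schurSeq, show m - 1 - (k : ℕ) + 1 = m - k by omega]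

theorem schurSeq_congr {z w : ℕ → ℂ} {m : ℕ} (h : ∀ k ≤ m, z k = w k) :
    schurSeq z m = schurSeq w m := by
  induction m using Nat.strong_induction_on generalizing z w with
  | _ m ih =>
    match m, ih, h with
    | 0, _, h => rw [schurSeq_zero, schurSeq_zero, h 0 le_rfl]
    | m + 1, ih, h =>
      rw [schurSeq_succ, schurSeq_succ, h 0 (by omega),
        ih m (by omega) fun k hk => h (k + 1) (by omega)]
      congr 2
      refine Finset.sum_congr rfl fun k hk => ?_
      rw [Finset.mem_range] at hk
      rw [ih (m - 1 - k) (by omega) fun j hj => h (j + 1) (by omega),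
        ih (k + 1) (by omega) fun j hj => h j (by omega)]

theorem schurSeq_succ_of_norm_eq_one {z : ℕ → ℂ} (h : ‖z 0‖ = 1) (m : ℕ) :
    schurSeq z (m + 1) = 0 := by
  induction m using Nat.strong_induction_on with
  | _ m ih =>
    rw [schurSeq_succ, h, Finset.sum_eq_zero]
    · simp
    · intro k hk
      rw [ih k (Finset.mem_range.1 hk), mul_zero]

/-- The inverse of one step of the Schur recursion: it recovers the sequence `schurSeq` of the
shifted parameters from that of all parameters, if the first parameter `c 0` is not unimodular. -/
noncomputable def schurStep (c : ℕ → ℂ) : ℕ → ℂ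
  | m => (c (m + 1) + conj (c 0) * ∑ k : Fin m, schurStep c (m - 1 - k) * c (k + 1)) /
      (1 - (‖c 0‖ : ℂ) ^ 2)
  decreasing_by omega

theorem schurStep_eq (c : ℕ → ℂ) (m : ℕ) :
    schurStep c m = (c (m + 1) + conj (c 0) * ∑ k ∈ Finset.range m,
      schurStep c (m - 1 - k) * c (k + 1)) / (1 - (‖c 0‖ : ℂ) ^ 2) := by
  rw [schurStep, ← Fin.sum_univ_eq_sum_range (fun k => schurStep c (m - 1 - k) * c (k + 1))]

/-- The `i`-th Schur parameter of the sequence `c`. It is meaningful only if the preceding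
parameters are not unimodular; otherwise a division by zero occurs in `schurStep`. -/
noncomputable def schurParam : ℕ → (ℕ → ℂ) → ℂ
  | 0, c => c 0
  | i + 1, c => schurParam i (schurStep c)

theorem one_sub_norm_sq_ne_zero {a : ℂ} (h : ‖a‖ < 1) : 1 - (‖a‖ : ℂ) ^ 2 ≠ 0 := by
  have h0 := norm_nonneg a
  have : (1 - ‖a‖ ^ 2 : ℝ) ≠ 0 := by nlinarith
  exact_mod_cast this

theorem schurStep_congr {c d : ℕ → ℂ} {m : ℕ} (h : ∀ k ≤ m + 1, c k = d k) :
    schurStep c m = schurStep d m := by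
  induction m using Nat.strong_induction_on with
  | _ m ih =>
    rw [schurStep_eq, schurStep_eq, h 0 (by omega), h (m + 1) le_rfl]
    congr 3
    refine Finset.sum_congr rfl fun k hk => ?_
    rw [Finset.mem_range] at hk
    rw [ih (m - 1 - k) (by omega) fun j hj => h j (by omega), h (k + 1) (by omega)]

theorem schurParam_congr {c d : ℕ → ℂ} {i : ℕ} (h : ∀ k ≤ i, c k = d k) :
    schurParam i c = schurParam i d := by
  induction i generalizing c d with
  | zero => exact h 0 le_rfl
  | succ i ih => exact ih fun k hk => schurStep_congr fun j hj => h j (by omega)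

theorem schurStep_schurSeq {z : ℕ → ℂ} (h : ‖z 0‖ < 1) :
    schurStep (schurSeq z) = schurSeq fun i => z (i + 1) := by
  funext m
  induction m using Nat.strong_induction_on with
  | _ m ih =>
    rw [schurStep_eq, schurSeq_zero, div_eq_iff (one_sub_norm_sq_ne_zero h), schurSeq_succ]
    have e : ∑ k ∈ Finset.range m, schurStep (schurSeq z) (m - 1 - k) * schurSeq z (k + 1) =
        ∑ k ∈ Finset.range m, schurSeq (fun i => z (i + 1)) (m - 1 - k) * schurSeq z (k + 1) :=
      Finset.sum_congr rfl fun k hk => by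
        rw [Finset.mem_range] at hk
        rw [ih (m - 1 - k) (by omega)]
    rw [e]
    ring

theorem schurParam_schurSeq {z : ℕ → ℂ} {i : ℕ} (h : ∀ j < i, ‖z j‖ < 1) :
    schurParam i (schurSeq z) = z i := by
  induction i generalizing z with
  | zero => exact schurSeq_zero z
  | succ i ih =>
    rw [schurParam, schurStep_schurSeq (h 0 (by omega))]
    exact ih fun j hj => h (j + 1) (by omega)

theorem schurSeq_schurParam {c : ℕ → ℂ} {m : ℕ} (h : ∀ j < m, ‖schurParam j c‖ < 1) :
    schurSeq (fun i => schurParam i c) m = c m := by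
  induction m using Nat.strong_induction_on generalizing c with
  | _ m ih =>
    match m, ih, h with
    | 0, _, h => rw [schurSeq_zero, schurParam]
    | m + 1, ih, h =>
      have h0 : ‖c 0‖ < 1 := h 0 (by omega)
      have hs : ∀ k ≤ m, schurSeq (fun i => schurParam (i + 1) c) k = schurStep c k := fun k hk =>
        ih k (by omega) fun j hj => h (j + 1) (by omega)
      rw [schurSeq_succ, hs m le_rfl, schurStep_eq]
      have e : ∑ k ∈ Finset.range m, schurSeq (fun i => schurParam (i + 1) c) (m - 1 - k) *
          schurSeq (fun i => schurParam i c) (k + 1) =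
          ∑ k ∈ Finset.range m, schurStep c (m - 1 - k) * c (k + 1) :=
        Finset.sum_congr rfl fun k hk => by
          rw [Finset.mem_range] at hk
          rw [hs _ (by omega), ih (k + 1) (by omega) fun j hj => h j (by omega)]
      rw [e, schurParam, mul_div_cancel₀ _ (one_sub_norm_sq_ne_zero h0)]
      ring

theorem analyticAt_one_sub_norm_sq {E : Type*} [NormedAddCommGroup E] [NormedSpace ℝ E]
    {u : E → ℂ} {x : E} (hu : AnalyticAt ℝ u x) :
    AnalyticAt ℝ (fun y => 1 - (‖u y‖ : ℂ) ^ 2) x := by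
  have hc : AnalyticAt ℝ (fun y => conj (u y)) x :=
    (Complex.conjCLE.toContinuousLinearMap.analyticAt _).comp hu
  have : (fun y => 1 - (‖u y‖ : ℂ) ^ 2) = fun y => 1 - conj (u y) * u y := by
    funext y
    rw [Complex.conj_mul']
  rw [this]
  exact analyticAt_const.sub (hc.mul hu)

theorem AnalyticAt.conj_real {E : Type*} [NormedAddCommGroup E] [NormedSpace ℝ E]
    {u : E → ℂ} {x : E} (hu : AnalyticAt ℝ u x) : AnalyticAt ℝ (fun y => conj (u y)) x :=
  (Complex.conjCLE.toContinuousLinearMap.analyticAt _).comp hu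

theorem analyticAt_schurSeq {E : Type*} [NormedAddCommGroup E] [NormedSpace ℝ E]
    {u : E → ℕ → ℂ} {x : E} (hu : ∀ k, AnalyticAt ℝ (fun y => u y k) x) (m : ℕ) :
    AnalyticAt ℝ (fun y => schurSeq (u y) m) x := by
  induction m using Nat.strong_induction_on generalizing u with
  | _ m ih =>
    match m, ih with
    | 0, _ => simpa only [schurSeq_zero] using hu 0
    | m + 1, ih =>
      rw [funext fun y => schurSeq_succ (u y) m]
      refine ((analyticAt_one_sub_norm_sq (hu 0)).mul
        (ih m (by omega) fun k => hu (k + 1))).sub ((hu 0).conj_real.mul ?_)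
      refine Finset.analyticAt_fun_sum _ fun k hk => ?_
      rw [Finset.mem_range] at hk
      exact (ih _ (by omega) fun k => hu (k + 1)).mul (ih _ (by omega) hu)

theorem analyticAt_schurStep {E : Type*} [NormedAddCommGroup E] [NormedSpace ℝ E]
    {u : E → ℕ → ℂ} {x : E} (hu : ∀ k, AnalyticAt ℝ (fun y => u y k) x) (h0 : ‖u x 0‖ < 1)
    (m : ℕ) : AnalyticAt ℝ (fun y => schurStep (u y) m) x := by
  induction m using Nat.strong_induction_on with
  | _ m ih =>
    have e : (fun y => schurStep (u y) m) = fun y => (u y (m + 1) + conj (u y 0) *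
        ∑ k ∈ Finset.range m, schurStep (u y) (m - 1 - k) * u y (k + 1)) *
        (1 - (‖u y 0‖ : ℂ) ^ 2)⁻¹ := by
      funext y
      rw [schurStep_eq, div_eq_mul_inv]
    rw [e]
    refine ((hu (m + 1)).add ((hu 0).conj_real.mul ?_)).mul
      ((analyticAt_one_sub_norm_sq (hu 0)).inv (one_sub_norm_sq_ne_zero h0))
    refine Finset.analyticAt_fun_sum _ fun k hk => ?_
    rw [Finset.mem_range] at hk
    exact (ih _ (by omega)).mul (hu (k + 1))

theorem analyticAt_schurParam {E : Type*} [NormedAddCommGroup E] [NormedSpace ℝ E]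
    {u : E → ℕ → ℂ} {x : E} (hu : ∀ k, AnalyticAt ℝ (fun y => u y k) x) {i : ℕ}
    (h : ∀ j < i, ‖schurParam j (u x)‖ < 1) : AnalyticAt ℝ (fun y => schurParam i (u y)) x := by
  induction i generalizing u with
  | zero => exact hu 0
  | succ i ih =>
    exact ih (analyticAt_schurStep hu (h 0 (by omega))) fun j hj => h (j + 1) (by omega)

/-! ### The Schur map on the polydisk -/

/-- Extension of a vector by zero to a sequence. -/
noncomputable def zeroExtend {N : ℕ} (z : Fin N → ℂ) (k : ℕ) : ℂ :=
  if h : k < N then z ⟨k, h⟩ else 0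

theorem zeroExtend_val {N : ℕ} (z : Fin N → ℂ) (i : Fin N) : zeroExtend z i = z i := by
  simp [zeroExtend]

theorem norm_zeroExtend_le_one {N : ℕ} {z : Fin N → ℂ} (hz : z ∈ closedPolydisk N) (k : ℕ) :
    ‖zeroExtend z k‖ ≤ 1 := by
  unfold zeroExtend
  split_ifs with h
  · exact hz _
  · simp

theorem analyticAt_zeroExtend {N : ℕ} (k : ℕ) (x : Fin N → ℂ) :
    AnalyticAt ℝ (fun z : Fin N → ℂ => zeroExtend z k) x := by
  unfold zeroExtend
  split_ifs with h
  · exact (ContinuousLinearMap.proj (R := ℝ) (φ := fun _ : Fin N => ℂ) ⟨k, h⟩).analyticAt x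
  · exact analyticAt_const

theorem schurMap_apply {N : ℕ} (z : Fin N → ℂ) (i : Fin N) :
    schurMap N z i = schurSeq (zeroExtend z) i :=
  rfl

theorem analyticAt_schurMap {N : ℕ} (x : Fin N → ℂ) : AnalyticAt ℝ (schurMap N) x :=
  AnalyticAt.pi fun i => analyticAt_schurSeq (fun k => analyticAt_zeroExtend k x) i

theorem continuous_schurMap (N : ℕ) : Continuous (schurMap N) :=
  continuous_iff_continuousAt.2 fun x => (analyticAt_schurMap x).continuousAt

/-- The Schur parameters of a vector of coefficients. The extension by zero is harmless: the `i`-th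
parameter depends on the coefficients of index at most `i` only. -/
noncomputable def schurMapInv (N : ℕ) (c : Fin N → ℂ) : Fin N → ℂ :=
  fun i => schurParam i (zeroExtend c)

theorem schurParam_schurMap {N : ℕ} {z : Fin N → ℂ} {i : Fin N} (h : ∀ j < i, ‖z j‖ < 1) :
    schurParam i (zeroExtend (schurMap N z)) = z i := by
  rw [schurParam_congr (d := schurSeq (zeroExtend z)), schurParam_schurSeq, zeroExtend_val]
  · intro j hj
    have : zeroExtend z j = z ⟨j, hj.trans i.2⟩ := zeroExtend_val z ⟨j, hj.trans i.2⟩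
    rw [this]
    exact h _ hj
  · intro k hk
    exact zeroExtend_val (schurMap N z) ⟨k, hk.trans_lt i.2⟩

theorem schurMapInv_schurMap {N : ℕ} {z : Fin N → ℂ} (hz : z ∈ openPolydisk N) :
    schurMapInv N (schurMap N z) = z :=
  funext fun _ => schurParam_schurMap fun j _ => hz j

theorem schurMap_schurMapInv {N : ℕ} {c : Fin N → ℂ} (hc : schurMapInv N c ∈ openPolydisk N) :
    schurMap N (schurMapInv N c) = c := by
  funext i
  rw [schurMap_apply, schurSeq_congr (w := fun k => schurParam k (zeroExtend c)),
    schurSeq_schurParam, zeroExtend_val]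
  · intro j hj
    exact hc ⟨j, hj.trans i.2⟩
  · intro k hk
    exact zeroExtend_val (schurMapInv N c) ⟨k, hk.trans_lt i.2⟩

theorem schurMap_image_openPolydisk (N : ℕ) :
    schurMap N '' openPolydisk N = schurMapInv N ⁻¹' openPolydisk N := by
  ext c
  constructor
  · rintro ⟨z, hz, rfl⟩
    rw [Set.mem_preimage, schurMapInv_schurMap hz]
    exact hz
  · intro hc
    exact ⟨_, hc, schurMap_schurMapInv hc⟩

theorem analyticAt_schurMapInv {N : ℕ} {c : Fin N → ℂ} (hc : schurMapInv N c ∈ openPolydisk N) :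
    AnalyticAt ℝ (schurMapInv N) c :=
  AnalyticAt.pi fun i => analyticAt_schurParam (fun k => analyticAt_zeroExtend k c)
    fun j hj => hc ⟨j, hj.trans i.2⟩

theorem openPolydisk_eq (N : ℕ) : openPolydisk N = Metric.ball 0 1 := by
  ext z
  simp [openPolydisk, pi_norm_lt_iff]

theorem closedPolydisk_eq (N : ℕ) : closedPolydisk N = Metric.closedBall 0 1 := by
  ext z
  simp [closedPolydisk, pi_norm_le_iff_of_nonneg]

theorem isOpen_openPolydisk (N : ℕ) : IsOpen (openPolydisk N) :=
  openPolydisk_eq N ▸ Metric.isOpen_ball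

theorem openPolydisk_subset (N : ℕ) : openPolydisk N ⊆ closedPolydisk N :=
  fun _ hz i => (hz i).le

theorem frontier_openPolydisk (N : ℕ) :
    frontier (openPolydisk N) = closedPolydisk N \ openPolydisk N := by
  rw [openPolydisk_eq, closedPolydisk_eq, frontier_ball _ one_ne_zero, Metric.closedBall_sdiff_ball]

theorem isOpen_schurMap_image_openPolydisk (N : ℕ) : IsOpen (schurMap N '' openPolydisk N) := by
  rw [schurMap_image_openPolydisk, isOpen_iff_mem_nhds]
  intro c hc
  exact (analyticAt_schurMapInv hc).continuousAt.preimage_mem_nhds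
    ((isOpen_openPolydisk N).mem_nhds hc)

/-- A boundary point `z` is not mapped into the interior of the image: at the first index `i` with
`‖z i‖ = 1`, the image of `z` is a limit of the images of points with the same preceding
parameters and `i`-th parameter `(1 + ε) z i`, and these images are not attained on the closed
polydisk, since the preceding parameters determine the `i`-th one. -/
theorem mem_openPolydisk_of_schurMap_mem_interior {N : ℕ} {z : Fin N → ℂ}
    (hz : z ∈ closedPolydisk N) (h : schurMap N z ∈ interior (schurMap N '' closedPolydisk N)) :
    z ∈ openPolydisk N := by
  intro i
  induction i using WellFoundedLT.induction with
  | ind i ih =>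
    by_contra hi
    have hi1 : ‖z i‖ = 1 := le_antisymm (hz i) (not_lt.1 hi)
    set w : ℝ → Fin N → ℂ := fun t => Function.update z i ((1 + t : ℝ) * z i) with hw
    have hwc : Continuous fun t => schurMap N (w t) :=
      (continuous_schurMap N).comp (continuous_const.update i (by fun_prop))
    have hw0 : w 0 = z := by simp [hw]
    have hev : ∀ᶠ t in 𝓝 (0 : ℝ), schurMap N (w t) ∈ schurMap N '' closedPolydisk N :=
      hwc.continuousAt.eventually_mem (mem_interior_iff_mem_nhds.1 (by simpa only [hw0] using h))
    obtain ⟨t, ⟨y, hy, hyt⟩, ht⟩ :=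
      ((hev.filter_mono nhdsWithin_le_nhds).and
        (self_mem_nhdsWithin : ∀ᶠ t in 𝓝[>] (0 : ℝ), t ∈ Set.Ioi 0)).exists
    have hlow : ∀ j < i, w t j = z j := fun j hj => by simp [hw, hj.ne]
    have key : ∀ j ≤ i, y j = w t j := by
      intro j
      induction j using WellFoundedLT.induction with
      | ind j ihj =>
        intro hj
        have hlt : ∀ k < j, ‖w t k‖ < 1 := fun k hk => by
          rw [hlow k (hk.trans_le hj)]
          exact ih k (hk.trans_le hj)
        rw [← schurParam_schurMap hlt, ← schurParam_schurMap (z := y), hyt]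
        intro k hk
        rw [ihj k hk (hk.le.trans hj)]
        exact hlt k hk
    have h1 := hy i
    rw [key i le_rfl] at h1
    have ht' : (0 : ℝ) < t := ht
    simp only [hw, Function.update_self, norm_mul, hi1, mul_one, Complex.norm_real,
      Real.norm_eq_abs] at h1
    rw [abs_of_pos (by linarith)] at h1
    linarith

theorem isClosed_schurMap_image_closedPolydisk (N : ℕ) :
    IsClosed (schurMap N '' closedPolydisk N) := by
  rw [closedPolydisk_eq]
  exact ((isCompact_closedBall 0 1).image (continuous_schurMap N)).isClosed

theorem interior_schurMap_image_closedPolydisk (N : ℕ) :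
    schurMap N '' openPolydisk N = interior (schurMap N '' closedPolydisk N) := by
  refine Set.Subset.antisymm (interior_maximal (Set.image_mono (openPolydisk_subset N))
    (isOpen_schurMap_image_openPolydisk N)) fun c hc => ?_
  obtain ⟨z, hz, rfl⟩ := interior_subset hc
  exact ⟨z, mem_openPolydisk_of_schurMap_mem_interior hz hc, rfl⟩

theorem frontier_schurMap_image_closedPolydisk (N : ℕ) :
    schurMap N '' frontier (openPolydisk N) = frontier (schurMap N '' closedPolydisk N) := by
  rw [(isClosed_schurMap_image_closedPolydisk N).frontier_eq, frontier_openPolydisk]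
  ext c
  constructor
  · rintro ⟨z, ⟨hz, hzo⟩, rfl⟩
    exact ⟨⟨z, hz, rfl⟩, fun h => hzo (mem_openPolydisk_of_schurMap_mem_interior hz h)⟩
  · rintro ⟨⟨z, hz, rfl⟩, h⟩
    refine ⟨z, ⟨hz, fun hzo => h ?_⟩, rfl⟩
    rw [← interior_schurMap_image_closedPolydisk]
    exact ⟨z, hzo, rfl⟩

/-- Once the first parameter is unimodular, the remaining ones do not matter. -/
theorem not_injOn_schurMap {N : ℕ} (hN : 2 ≤ N) :
    ¬ Set.InjOn (schurMap N) (frontier (openPolydisk N)) := by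
  intro h
  set i₀ : Fin N := ⟨0, by omega⟩
  set i₁ : Fin N := ⟨1, by omega⟩
  have hmem : ∀ z : Fin N → ℂ, z i₀ = 1 → (∀ i, ‖z i‖ ≤ 1) → z ∈ frontier (openPolydisk N) := by
    intro z h0 hz
    rw [frontier_openPolydisk]
    exact ⟨hz, fun h => by simpa [h0] using h i₀⟩
  have himg : ∀ z : Fin N → ℂ, z i₀ = 1 → ∀ i : Fin N,
      schurMap N z i = if (i : ℕ) = 0 then 1 else 0 := by
    intro z h0 i
    have h0' : zeroExtend z 0 = 1 := (zeroExtend_val z i₀).trans h0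
    rw [schurMap_apply]
    obtain ⟨_ | i, hi⟩ := i
    · simpa using (schurSeq_zero _).trans h0'
    · simpa using schurSeq_succ_of_norm_eq_one (by simp [h0']) i
  have := h (hmem (fun _ => 1) rfl (by simp))
    (hmem (Pi.single i₀ 1) (by simp) fun i => by
      by_cases hi : i = i₀ <;> simp [hi])
    (funext fun i => by rw [himg _ rfl, himg _ (by simp)])
  have h1 := congrFun this i₁
  simp [i₀, i₁] at h1

/-! ### The coefficients of holomorphic self-maps of the disk -/

section SchurAlgorithm

open Polynomial

/-- The Schur class: holomorphic functions on the unit disk that are bounded by `1`. -/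
def schurClass : Set (ℂ → ℂ) :=
  {g | DifferentiableOn ℂ g (Metric.ball 0 1) ∧ ∀ z ∈ Metric.ball (0 : ℂ) 1, ‖g z‖ ≤ 1}

theorem DifferentiableOn.analyticAt_zero {g : ℂ → ℂ}
    (hg : DifferentiableOn ℂ g (Metric.ball 0 1)) : AnalyticAt ℂ g 0 :=
  hg.analyticAt (Metric.ball_mem_nhds 0 one_pos)

theorem norm_sub_le_norm_one_sub_conj_mul {a b : ℂ} (ha : ‖a‖ ≤ 1) (hb : ‖b‖ ≤ 1) :
    ‖a - b‖ ≤ ‖1 - conj b * a‖ := by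
  refine le_of_sq_le_sq ?_ (norm_nonneg _)
  have ha' : ‖a‖ ^ 2 ≤ 1 := pow_le_one₀ (norm_nonneg a) ha
  have hb' : ‖b‖ ^ 2 ≤ 1 := pow_le_one₀ (norm_nonneg b) hb
  have key : 0 ≤ (1 - ‖a‖ ^ 2) * (1 - ‖b‖ ^ 2) :=
    mul_nonneg (sub_nonneg.2 ha') (sub_nonneg.2 hb')
  rw [← Complex.normSq_eq_norm_sq, ← Complex.normSq_eq_norm_sq] at *
  simp only [Complex.normSq_apply, Complex.sub_re, Complex.sub_im, Complex.mul_re, Complex.mul_im,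
    Complex.conj_re, Complex.conj_im, Complex.one_re, Complex.one_im] at *
  nlinarith

/-- The recursion of the Schur map is the comparison of coefficients in
`P (1 + conj γ X Q) = γ + X Q`. -/
theorem coeff_eq_schurSeq {P Q : ℂ[X]} {z : ℕ → ℂ} {N : ℕ}
    (h : ∀ k ≤ N + 1, (P * (1 + C (conj (z 0)) * (X * Q))).coeff k = (C (z 0) + X * Q).coeff k)
    (hQ : ∀ k ≤ N, Q.coeff k = schurSeq (fun i => z (i + 1)) k) :
    ∀ k ≤ N + 1, P.coeff k = schurSeq z k := by
  have h0 : P.coeff 0 = z 0 := by simpa [mul_coeff_zero] using h 0 (by omega)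
  intro k
  induction k using Nat.strong_induction_on with
  | _ k ih =>
    match k, ih with
    | 0, _ => exact fun _ => by rw [h0, schurSeq_zero]
    | m + 1, ih =>
      intro hm
      have hc := h (m + 1) hm
      rw [show P * (1 + C (conj (z 0)) * (X * Q)) = P + C (conj (z 0)) * (X * (Q * P)) by ring,
        coeff_add, coeff_C_mul, coeff_X_mul, coeff_add, coeff_X_mul, coeff_C_succ, coeff_mul,
        ← Finset.Nat.sum_antidiagonal_swap] at hc
      simp only [Prod.fst_swap, Prod.snd_swap] at hc
      rw [Finset.Nat.sum_antidiagonal_eq_sum_range_succ (fun i j => Q.coeff j * P.coeff i),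
        Finset.sum_range_succ', h0, Nat.sub_zero] at hc
      have e : ∑ k ∈ Finset.range m, Q.coeff (m - (k + 1)) * P.coeff (k + 1) =
          ∑ k ∈ Finset.range m,
            schurSeq (fun i => z (i + 1)) (m - 1 - k) * schurSeq z (k + 1) :=
        Finset.sum_congr rfl fun k hk => by
          rw [Finset.mem_range] at hk
          rw [ih (k + 1) (by omega) (by omega), hQ _ (by omega), Nat.sub_sub, add_comm 1 k]
      rw [e, hQ m (by omega)] at hc
      rw [schurSeq_succ, ← Complex.conj_mul']
      linear_combination hc

/-- The Schur algorithm run backwards: every sequence of parameters in the closed disk comes from a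
function in the Schur class. -/
theorem exists_mem_schurClass_hasJet (N : ℕ) {z : ℕ → ℂ} (hz : ∀ i, ‖z i‖ ≤ 1) :
    ∃ g ∈ schurClass, ∃ P : ℂ[X], HasJet N g P ∧ ∀ k ≤ N, P.coeff k = schurSeq z k := by
  induction N generalizing z with
  | zero =>
    refine ⟨fun _ => z 0, ⟨differentiableOn_const _, fun _ _ => hz 0⟩, C (z 0), ?_, ?_⟩
    · simpa using HasJet.eval (n := 0) (C (z 0))
    · intro k hk
      obtain rfl : k = 0 := by omega
      rw [coeff_C_zero, schurSeq_zero]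
  | succ N ih =>
    obtain ⟨g₁, ⟨hd, hb⟩, Q, hQ, hQc⟩ := ih fun i => hz (i + 1)
    have hw : ∀ w ∈ Metric.ball (0 : ℂ) 1, ‖conj (z 0) * (w * g₁ w)‖ < 1 := by
      intro w hw
      rw [mem_ball_zero_iff] at hw
      rw [norm_mul, norm_mul, RCLike.norm_conj]
      have h1 := hb w (mem_ball_zero_iff.2 hw)
      have h2 : ‖w‖ * ‖g₁ w‖ ≤ ‖w‖ := mul_le_of_le_one_right (norm_nonneg w) h1
      exact (mul_le_of_le_one_left (by positivity) (hz 0)).trans_lt (h2.trans_lt hw)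
    have hne : ∀ w ∈ Metric.ball (0 : ℂ) 1, 1 + conj (z 0) * (w * g₁ w) ≠ 0 := by
      intro w hw0 h0
      have h1 := hw w hw0
      rw [eq_neg_of_add_eq_zero_right h0, norm_neg, norm_one] at h1
      exact lt_irrefl _ h1
    set g : ℂ → ℂ := fun w => (z 0 + w * g₁ w) / (1 + conj (z 0) * (w * g₁ w)) with hg
    have hgd : DifferentiableOn ℂ g (Metric.ball 0 1) :=
      ((differentiableOn_id.mul hd).const_add _).div
        (((differentiableOn_id.mul hd).const_mul _).const_add _) hne
    obtain ⟨P, hP⟩ := hgd.analyticAt_zero.exists_hasJet (N + 1)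
    have hXQ : HasJet (N + 1) (fun w => w * g₁ w) (X * Q) := by
      have hX : HasJet (N + 1) (fun w => w) X := by simpa using HasJet.eval (n := N + 1) X
      exact hX.mul_of_X_dvd dvd_rfl hQ
    refine ⟨g, ⟨hgd, fun w hw0 => ?_⟩, P, hP, coeff_eq_schurSeq (Q := Q) ?_ hQc⟩
    · rw [hg, norm_div, div_le_one (norm_pos_iff.2 (hne w hw0))]
      have h1 : ‖w * g₁ w‖ ≤ 1 := by
        rw [norm_mul]
        exact mul_le_one₀ (mem_ball_zero_iff.1 hw0).le (norm_nonneg _) (hb w hw0)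
      have := norm_sub_le_norm_one_sub_conj_mul h1 (b := -z 0) (by simpa using hz 0)
      simpa [add_comm] using this
    · have hC : ∀ a : ℂ, HasJet (N + 1) (fun _ => a) (C a) := fun a => by
        simpa using HasJet.eval (n := N + 1) (C a)
      have h1 := hP.mul ((hC 1).add ((hC (conj (z 0))).mul hXQ))
      rw [C_1] at h1
      refine h1.coeff_eq (((hC (z 0)).add hXQ).congr ?_)
      filter_upwards [Metric.ball_mem_nhds (0 : ℂ) one_pos] with w hw0
      rw [hg, div_mul_cancel₀ _ (hne w hw0)]

theorem dslope_mem_schurClass {h : ℂ → ℂ} (hd : DifferentiableOn ℂ h (Metric.ball 0 1))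
    (hb : ∀ z ∈ Metric.ball (0 : ℂ) 1, ‖h z‖ ≤ 1) (h0 : h 0 = 0) : dslope h 0 ∈ schurClass := by
  refine ⟨(Complex.differentiableOn_dslope (Metric.ball_mem_nhds 0 one_pos)).2 hd,
    fun z hz => ?_⟩
  have := Complex.norm_dslope_le_div_of_mapsTo_ball (R₂ := 1) hd
    (fun w hw => by simpa [h0] using hb w hw) hz
  simpa using this

theorem mul_dslope_zero {h : ℂ → ℂ} (h0 : h 0 = 0) (z : ℂ) : z * dslope h 0 z = h z := by
  simpa [h0] using sub_smul_dslope h 0 z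

/-- The Schur algorithm: the coefficients of a function in the Schur class are given by parameters
in the closed disk. -/
theorem exists_schurSeq_eq_coeff (N : ℕ) {g : ℂ → ℂ} (hg : g ∈ schurClass) {P : ℂ[X]}
    (hP : HasJet N g P) :
    ∃ z : ℕ → ℂ, (∀ i, ‖z i‖ ≤ 1) ∧ ∀ k ≤ N, P.coeff k = schurSeq z k := by
  have hball : (0 : ℂ) ∈ Metric.ball (0 : ℂ) 1 := Metric.mem_ball_self one_pos
  induction N generalizing g P with
  | zero =>
    refine ⟨fun _ => g 0, fun _ => hg.2 0 hball, fun k hk => ?_⟩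
    obtain rfl : k = 0 := by omega
    rw [hP.coeff_zero, schurSeq_zero]
  | succ N ih =>
    obtain ⟨hd, hb⟩ := hg
    have hC : ∀ a : ℂ, HasJet (N + 1) (fun _ => a) (C a) := fun a => by
      simpa using HasJet.eval (n := N + 1) (C a)
    rcases (hb 0 hball).eq_or_lt with h1 | h1
    -- By the maximum principle `g` is constant, and all parameters may be taken equal to `g 0`.
    · have hconst := Complex.eqOn_of_isPreconnected_of_isMaxOn_norm
        (convex_ball (0 : ℂ) 1).isPreconnected Metric.isOpen_ball hd hball
        (fun z hz => by simpa [h1] using hb z hz)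
      have hP' : HasJet (N + 1) (fun _ => g 0) P := by
        refine hP.congr ?_
        filter_upwards [Metric.ball_mem_nhds (0 : ℂ) one_pos] with w hw
        exact hconst hw
      refine ⟨fun _ => g 0, fun _ => hb 0 hball, fun k hk => ?_⟩
      rw [hP'.coeff_eq (hC (g 0)) k hk]
      match k with
      | 0 => rw [coeff_C_zero, schurSeq_zero]
      | k + 1 => rw [coeff_C_succ, schurSeq_succ_of_norm_eq_one h1]
    -- `g` followed by the disk automorphism that moves `g 0` to `0`, divided by the variable, is
    -- the next function of the algorithm.
    · have hne : ∀ w ∈ Metric.ball (0 : ℂ) 1, 1 - conj (g 0) * g w ≠ 0 := by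
        intro w hw h0
        have h2 : ‖conj (g 0) * g w‖ < 1 := by
          rw [norm_mul, RCLike.norm_conj]
          exact (mul_le_of_le_one_right (norm_nonneg _) (hb w hw)).trans_lt h1
        rw [← sub_eq_zero.1 h0, norm_one] at h2
        exact lt_irrefl _ h2
      set h : ℂ → ℂ := fun w => (g w - g 0) / (1 - conj (g 0) * g w) with hh
      have hhd : DifferentiableOn ℂ h (Metric.ball 0 1) :=
        (hd.sub_const _).div ((hd.const_mul _).const_sub _) hne
      have hh0 : h 0 = 0 := by simp [hh]
      have hg₁ : dslope h 0 ∈ schurClass := by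
        refine dslope_mem_schurClass hhd (fun w hw => ?_) hh0
        rw [hh, norm_div, div_le_one (norm_pos_iff.2 (hne w hw))]
        exact norm_sub_le_norm_one_sub_conj_mul (hb w hw) (hb 0 hball)
      obtain ⟨Q, hQ⟩ := hg₁.1.analyticAt_zero.exists_hasJet N
      obtain ⟨z, hz, hzQ⟩ := ih hg₁ hQ
      have hXQ : HasJet (N + 1) (fun w => w * dslope h 0 w) (X * Q) := by
        have hX : HasJet (N + 1) (fun w => w) X := by simpa using HasJet.eval (n := N + 1) X
        exact hX.mul_of_X_dvd dvd_rfl hQ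
      refine ⟨fun i => Nat.casesOn i (g 0) z, fun i => ?_, coeff_eq_schurSeq (Q := Q) ?_ hzQ⟩
      · cases i with
        | zero => exact hb 0 hball
        | succ i => exact hz i
      · have h2 := hP.mul ((hC 1).add ((hC (conj (g 0))).mul hXQ))
        rw [C_1] at h2
        refine h2.coeff_eq (((hC (g 0)).add hXQ).congr ?_)
        filter_upwards [Metric.ball_mem_nhds (0 : ℂ) one_pos] with w hw
        rw [mul_dslope_zero hh0]
        have key : h w * (1 - conj (g 0) * g w) = g w - g 0 := div_mul_cancel₀ _ (hne w hw)
        linear_combination key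

theorem coeff_coeffPoly_succ {N : ℕ} (c : Fin N → ℂ) (k : ℕ) :
    (coeffPoly c).coeff (k + 1) = zeroExtend c k := by
  simp only [coeffPoly, finsetSum_coeff, coeff_C_mul, coeff_X_pow, add_left_inj, mul_ite, mul_one,
    mul_zero, zeroExtend]
  split_ifs with h
  · rw [Finset.sum_eq_single (⟨k, h⟩ : Fin N)] <;> simp +contextual [Fin.ext_iff, eq_comm]
  · exact Finset.sum_eq_zero fun i _ => if_neg fun hi : k = i => h (hi ▸ i.2)

/-- **Schur's theorem**: the Schur map sends the closed polydisk onto the coefficient body of the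
holomorphic self-maps of the disk that fix the origin. -/
theorem schurMap_image_closedPolydisk {N : ℕ} (hN : 1 ≤ N) :
    schurMap N '' closedPolydisk N =
      {c | ∃ ω ∈ selfMapsVanishing, HasJet N ω (coeffPoly c)} := by
  obtain ⟨M, rfl⟩ : ∃ M, N = M + 1 := ⟨N - 1, by omega⟩
  have hX : HasJet (M + 1) (fun w => w) X := by simpa using HasJet.eval (n := M + 1) X
  ext c
  constructor
  · rintro ⟨z, hz, rfl⟩
    obtain ⟨g, ⟨hd, hb⟩, P, hP, hPc⟩ :=
      exists_mem_schurClass_hasJet M (norm_zeroExtend_le_one hz)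
    refine ⟨fun w => w * g w, ⟨differentiableOn_id.mul hd, fun w hw => ?_, by simp⟩,
      (hX.mul_of_X_dvd dvd_rfl hP).congr_poly (X_pow_dvd_iff.2 fun k hk => ?_)⟩
    · rw [mem_ball_zero_iff] at hw ⊢
      rw [norm_mul]
      exact (mul_le_of_le_one_right (norm_nonneg _) (hb w (mem_ball_zero_iff.2 hw))).trans_lt hw
    · rw [coeff_sub, sub_eq_zero]
      match k with
      | 0 => rw [coeff_X_mul_zero, X_dvd_iff.1 (X_dvd_coeffPoly _)]
      | k + 1 =>
        rw [coeff_X_mul, coeff_coeffPoly_succ, hPc k (by omega)]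
        exact (zeroExtend_val (schurMap (M + 1) z) ⟨k, by omega⟩).symm
  · rintro ⟨ω, ⟨hd, hm, h0⟩, hc⟩
    have hg : dslope ω 0 ∈ schurClass :=
      dslope_mem_schurClass hd (fun w hw => (mem_ball_zero_iff.1 (hm hw)).le) h0
    obtain ⟨P, hP⟩ := hg.1.analyticAt_zero.exists_hasJet M
    obtain ⟨z, hz, hzP⟩ := exists_schurSeq_eq_coeff M hg hP
    refine ⟨fun i => z i, fun i => hz i, funext fun i => ?_⟩
    have h1 := ((hX.mul_of_X_dvd dvd_rfl hP).congr (Eventually.of_forall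
      (mul_dslope_zero h0))).coeff_eq hc (i + 1) i.2
    rw [coeff_X_mul, coeff_coeffPoly_succ, zeroExtend_val, hzP i (Nat.lt_succ_iff.1 i.2)] at h1
    rw [← h1, schurMap_apply]
    exact schurSeq_congr fun k hk =>
      zeroExtend_val (fun i : Fin (M + 1) => z i) ⟨k, hk.trans_lt i.2⟩

end SchurAlgorithm

/-! ### The coefficients of the inverse functions -/

section InverseCoefficients

open Polynomial

theorem IsInverseAtZero.coeff_eq {F G : ℂ → ℂ} (h : IsInverseAtZero F G) {n : ℕ} (hn : 1 ≤ n)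
    {H P : ℂ[X]} (hF : HasJet n F H) (hH : X ∣ H) (hH1 : H.coeff 1 ≠ 0) (hG : HasJet n G P) :
    ∀ k ≤ n, P.coeff k = invCoeff H k := by
  refine coeff_eq_invCoeff hH hH1 ((hG.comp hF hn hH).coeff_eq ?_)
  have hX : HasJet n (fun z => z) X := by simpa using HasJet.eval (n := n) X
  exact hX.congr (h.2.2.2.mono fun z hz => hz.symm)

theorem mem_coeffBodyTwo_iff {N : ℕ} {𝓕 : Set (ℂ → ℂ)} {v : Fin N → ℂ} :
    v ∈ coeffBodyTwo (N + 1) 𝓕 ↔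
      ∃ f ∈ 𝓕, ∃ p : ℂ[X], HasJet (N + 1) f p ∧ ∀ i : Fin N, v i = p.coeff ((i : ℕ) + 2) := by
  constructor
  · rintro ⟨f, hf, a, ha, hv⟩
    refine ⟨f, hf, ∑ k ∈ Finset.range (N + 1 + 1), C (a k) * X ^ k, ?_, fun i => ?_⟩
    · simpa only [HasJet, eval_finsetSum, eval_mul, eval_C, eval_pow, eval_X] using ha
    · rw [hv i, finsetSum_coeff, Finset.sum_eq_single ((i : ℕ) + 2)]
      · simp
      · intro k _ hk
        simp [coeff_X_pow, hk.symm]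
      · intro h
        have := i.2
        simp only [Finset.mem_range] at h
        omega
  · rintro ⟨f, hf, p, hp, hv⟩
    have h : HasJet (N + 1) f (∑ k ∈ Finset.range (N + 1 + 1), C (p.coeff k) * X ^ k) := by
      refine hp.congr_poly (X_pow_dvd_iff.2 fun k hk => ?_)
      simp [finsetSum_coeff, coeff_X_pow, hk]
    refine ⟨f, hf, p.coeff, ?_, hv⟩
    simpa only [HasJet, eval_finsetSum, eval_mul, eval_C, eval_pow, eval_X] using h

/-- The coefficient body of the inverse functions is the image of the coefficient body of the
functions `ω`. -/
theorem coeffBodyTwo_classB {φ ψ : ℂ → ℂ} (hφ : DifferentiableOn ℂ φ (Metric.ball 0 1))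
    (hψ : DifferentiableOn ℂ ψ (Metric.ball 0 1)) {N : ℕ} (hN : 1 ≤ N) {p q : ℂ[X]}
    (hp : HasJet (N + 1) φ p) (hpX : X ∣ p) (hp1 : p.coeff 1 ≠ 0)
    (hq : HasJet N ψ q) (hq0 : q.coeff 0 ≠ 0) {K : Fin N → MvPolynomial (Fin N) ℂ}
    (hK : ∀ c i, polyMap K c i = invCoeff (p * q.comp (coeffPoly c)) ((i : ℕ) + 2)) :
    coeffBodyTwo (N + 1) (classB φ ψ) =
      polyMap K '' {c | ∃ ω ∈ selfMapsVanishing, HasJet N ω (coeffPoly c)} := by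
  have hX : ∀ c : Fin N → ℂ, X ∣ p * q.comp (coeffPoly c) := fun c => hpX.mul_right _
  have hH1 : ∀ c : Fin N → ℂ, (p * q.comp (coeffPoly c)).coeff 1 ≠ 0 := fun c => by
    rw [coeff_one_mul_comp_coeffPoly hpX]
    exact mul_ne_zero hp1 hq0
  have hF : ∀ (c : Fin N → ℂ) (ω F : ℂ → ℂ), HasJet N ω (coeffPoly c) →
      (∀ z ∈ Metric.ball (0 : ℂ) 1, F z = φ z * ψ (ω z)) →
      HasJet (N + 1) F (p * q.comp (coeffPoly c)) := fun c ω F hω hF => by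
    refine (hp.mul_of_X_dvd hpX (hq.comp hω hN (X_dvd_coeffPoly c))).congr ?_
    filter_upwards [Metric.ball_mem_nhds (0 : ℂ) one_pos] with z hz
    exact (hF z hz).symm
  ext v
  refine mem_coeffBodyTwo_iff.trans ⟨?_, ?_⟩
  · rintro ⟨G, ⟨F, ⟨-, ω, hω, hFω⟩, hinv⟩, P, hP, hv⟩
    obtain ⟨r, hr⟩ := hω.1.analyticAt_zero.exists_hasJet N
    set c : Fin N → ℂ := fun i => r.coeff (i + 1)
    have hc : HasJet N ω (coeffPoly c) := by
      refine hr.congr_poly (X_pow_dvd_iff.2 fun k hk => ?_)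
      rw [coeff_sub, sub_eq_zero]
      match k with
      | 0 => rw [hr.coeff_zero, hω.2.2, X_dvd_iff.1 (X_dvd_coeffPoly _)]
      | k + 1 =>
        rw [coeff_coeffPoly_succ]
        exact (zeroExtend_val c ⟨k, by omega⟩).symm
    refine ⟨c, ⟨ω, hω, hc⟩, funext fun i => ?_⟩
    have := i.2
    rw [hK, hv i, hinv.coeff_eq (by omega) (hF c ω F hc hFω) (hX c) (hH1 c) hP _ (by omega)]
  · rintro ⟨c, ⟨ω, hω, hc⟩, rfl⟩
    set F : ℂ → ℂ := fun z => φ z * ψ (ω z) with hFdef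
    have hFd : DifferentiableOn ℂ F (Metric.ball 0 1) := hφ.mul (hψ.comp hω.1 hω.2.1)
    have hFjet := hF c ω F hc fun _ _ => rfl
    obtain ⟨G, hG⟩ := exists_isInverseAtZero hFd.analyticAt_zero
      (by rw [← hFjet.coeff_zero, X_dvd_iff.1 (hX c)])
      (by rw [(hFjet.hasDerivAt (by omega)).deriv]; exact hH1 c)
    obtain ⟨P, hP⟩ := hG.1.exists_hasJet (N + 1)
    refine ⟨G, ⟨F, ⟨hFd, ω, hω, fun _ _ => rfl⟩, hG⟩, P, hP, fun i => ?_⟩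
    have := i.2
    rw [hK, hG.coeff_eq (by omega) hFjet (hX c) (hH1 c) hP _ (by omega)]

end InverseCoefficients

/-! ### Polynomial automorphisms applied to the Schur map -/

theorem analyticAt_polyMap {N : ℕ} (K : Fin N → MvPolynomial (Fin N) ℂ) (x : Fin N → ℂ) :
    AnalyticAt ℝ (polyMap K) x :=
  AnalyticAt.pi fun i =>
    ((AnalyticOnNhd.eval_mvPolynomial (K i)) x (Set.mem_univ x)).restrictScalars

theorem continuous_polyMap {N : ℕ} (K : Fin N → MvPolynomial (Fin N) ℂ) :
    Continuous (polyMap K) :=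
  continuous_pi fun i => MvPolynomial.continuous_eval (K i)

theorem IsPolyAutomorphism.exists_homeomorph {N : ℕ} {K : Fin N → MvPolynomial (Fin N) ℂ}
    (hK : IsPolyAutomorphism K) : ∃ e : (Fin N → ℂ) ≃ₜ (Fin N → ℂ), ⇑e = polyMap K := by
  obtain ⟨J, hl, hr⟩ := hK
  exact ⟨⟨⟨polyMap K, polyMap J, hl, hr⟩, continuous_polyMap K, continuous_polyMap J⟩, rfl⟩

theorem isRealAnalyticDiffeoOn_polyMap_comp_schurMap {N : ℕ}
    {K : Fin N → MvPolynomial (Fin N) ℂ} (hK : IsPolyAutomorphism K) :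
    IsRealAnalyticDiffeoOn (polyMap K ∘ schurMap N) (openPolydisk N) := by
  obtain ⟨e, he⟩ := hK.exists_homeomorph
  obtain ⟨J, hl, -⟩ := hK
  refine ⟨isOpen_openPolydisk N, ?_,
    fun x _ => (analyticAt_polyMap K _).comp (analyticAt_schurMap x),
    schurMapInv N ∘ polyMap J, ?_, fun z hz => ?_⟩
  · rw [Set.image_comp, ← he]
    exact e.isOpenMap _ (isOpen_schurMap_image_openPolydisk N)
  · rintro _ ⟨z, hz, rfl⟩
    refine AnalyticAt.comp ?_ (analyticAt_polyMap J _)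
    rw [Function.comp_apply, hl (schurMap N z)]
    refine analyticAt_schurMapInv ?_
    rwa [schurMapInv_schurMap hz]
  · rw [Function.comp_apply, Function.comp_apply, hl (schurMap N z), schurMapInv_schurMap hz]

theorem theorem4p2 (φ ψ : ℂ → ℂ)
    (hφ : DifferentiableOn ℂ φ (Metric.ball 0 1)) (hψ : DifferentiableOn ℂ ψ (Metric.ball 0 1))
    (hφ0 : φ 0 = 0) (hφ1 : deriv φ 0 ≠ 0) (hψ0 : ψ 0 ≠ 0) (n : ℕ) (hn : 2 ≤ n) :
    ∃ K : Fin (n - 1) → MvPolynomial (Fin (n - 1)) ℂ,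
      ContinuousOn (polyMap K ∘ schurMap (n - 1)) (closedPolydisk (n - 1)) ∧
      (polyMap K ∘ schurMap (n - 1)) '' closedPolydisk (n - 1) =
        coeffBodyTwo n (classB φ ψ) ∧
      (deriv ψ 0 ≠ 0 →
        IsPolyAutomorphism K ∧
        (polyMap K ∘ schurMap (n - 1)) '' openPolydisk (n - 1) =
          interior (coeffBodyTwo n (classB φ ψ)) ∧
        (polyMap K ∘ schurMap (n - 1)) '' frontier (openPolydisk (n - 1)) =
          frontier (coeffBodyTwo n (classB φ ψ)) ∧
        IsRealAnalyticDiffeoOn (polyMap K ∘ schurMap (n - 1)) (openPolydisk (n - 1)) ∧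
        (3 ≤ n →
          ¬ Set.InjOn (polyMap K ∘ schurMap (n - 1)) (frontier (openPolydisk (n - 1))))) := by
  obtain ⟨N, rfl⟩ : ∃ N, n = N + 1 := ⟨n - 1, by omega⟩
  have hN : 1 ≤ N := by omega
  obtain ⟨p, hp⟩ := hφ.analyticAt_zero.exists_hasJet (N + 1)
  obtain ⟨q, hq⟩ := hψ.analyticAt_zero.exists_hasJet N
  have hpX : Polynomial.X ∣ p := Polynomial.X_dvd_iff.2 (hp.coeff_zero.trans hφ0)
  have hp1 : p.coeff 1 ≠ 0 := (hp.hasDerivAt (by omega)).deriv ▸ hφ1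
  have hq0 : q.coeff 0 ≠ 0 := hq.coeff_zero.symm ▸ hψ0
  obtain ⟨K, hK, hKaut⟩ := exists_polyMap_eq_invCoeff p q hpX N
  have hbody := coeffBodyTwo_classB hφ hψ hN hp hpX hp1 hq hq0 hK
  rw [← schurMap_image_closedPolydisk hN] at hbody
  refine ⟨K, ((continuous_polyMap K).comp (continuous_schurMap N)).continuousOn,
    (Set.image_comp _ _ _).trans hbody.symm, fun hψ1 => ?_⟩
  have hq1 : q.coeff 1 ≠ 0 := (hq.hasDerivAt hN).deriv ▸ hψ1
  have hA := hKaut hp1 hq0 hq1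
  obtain ⟨e, he⟩ := hA.exists_homeomorph
  rw [← he] at hbody
  refine ⟨hA, ?_, ?_, isRealAnalyticDiffeoOn_polyMap_comp_schurMap hA, fun h3 hinj => ?_⟩
  · refine (Set.image_comp _ _ _).trans ((?_ : _ = _).trans (congrArg interior hbody.symm))
    rw [← he]
    exact (congrArg (e '' ·) (interior_schurMap_image_closedPolydisk N)).trans
      (e.image_interior _)
  · refine (Set.image_comp _ _ _).trans ((?_ : _ = _).trans (congrArg frontier hbody.symm))
    rw [← he]
    exact (congrArg (e '' ·) (frontier_schurMap_image_closedPolydisk N)).trans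
      (e.image_frontier _)
  · exact not_injOn_schurMap (N := N) (by omega) fun x hx y hy hxy =>
      hinj hx hy (congrArg (polyMap K) hxy)
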